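/- Let $n,m\ge 1$, $\mathcal X=\mathbb C^n$, $\mathcal Y=\mathbb C^m$, and let $\Phi:L(\mathcal X)\to L(\mathcal Y)$ be a linear map, where $L(\mathcal V)$ denotes the linear operators on $\mathcal V$. Let $J(\Phi)=\sum_{i,j=1}^n\Phi(E_{i,j})\otimes E_{i,j}$, where $E_{i,j}$ are the matrix units of $L(\mathcal X)$, let $\mathcal Z=\mathbb C^r$ with $r=\operatorname{rank}J(\Phi)$, and let $A,B:\mathcal X\to\mathcal Y\otimes\mathcal Z$ be linear operators with $\Phi(X)=\operatorname{Tr}_{\mathcal Z}(AXB^*)$ for all $X\in L(\mathcal X)$. Write $\langle P,Q\rangle=\operatorname{Tr}(P^*Q)$, $\|M\|_1=\operatorname{Tr}\sqrt{M^*M}$, write $\|\cdot\|_\infty$ for the spectral norm, and let $$|||\Phi|||_1=\sup_{k\ge 1}\ \max\bigl\{\|(\Phi\otimes 1_{L(\mathbb C^k)})(X)\|_1 : X\in L(\mathcal X\otimes\mathbb C^k),\ \|X\|_1\le 1\bigr\}$$ be the completely bounded trace norm of $\Phi$. Consider the following two optimization problems. Primal problem: maximize $\langle BB^*,W\rangle$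 over all $\rho\in L(\mathcal X)$ and $W\in L(\mathcal Y\otimes\mathcal Z)$ with $\rho\ge 0$, $\operatorname{Tr}\rho=1$, $W\ge 0$ and $\operatorname{Tr}_{\mathcal Y}(W)=\operatorname{Tr}_{\mathcal Y}(A\rho A^*)$. Dual problem: minimize $\|A^*(1_{\mathcal Y}\otimes Z)A\|_\infty$ over all $Z\in L(\mathcal Z)$ with $Z\ge 0$ and $1_{\mathcal Y}\otimes Z\ge BB^*$. Then $|||\Phi|||_1$ is finite, strong duality holds, that is, the supremum of the primal problem equals the infimum of the dual problem, this common value is $|||\Phi|||_1^2$, and the supremum of the primal problem is attained. -/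

import Mathlib

open Matrix
open scoped Kronecker ENNReal ComplexOrder

noncomputable section

namespace CBTraceNorm

/-- The partial trace over the second tensor factor, `M ↦ Tr_Z M` for `M` on `Y ⊗ Z`. -/
def trRight {κ ζ : Type*} [Fintype ζ] (M : Matrix (κ × ζ) (κ × ζ) ℂ) : Matrix κ κ ℂ :=
  Matrix.of fun y y' => ∑ z, M (y, z) (y', z)

/-- The partial trace over the first tensor factor, `M ↦ Tr_Y M` for `M` on `Y ⊗ Z`. -/
def trLeft {κ ζ : Type*} [Fintype κ] (M : Matrix (κ × ζ) (κ × ζ) ℂ) : Matrix ζ ζ ℂ :=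
  Matrix.of fun z z' => ∑ y, M (y, z) (y, z')

theorem trRight_kronecker {κ ζ : Type*} [Fintype ζ] (P : Matrix κ κ ℂ) (Q : Matrix ζ ζ ℂ) :
    trRight (P ⊗ₖ Q) = Q.trace • P := by
  ext y y'
  simp [trRight, Matrix.trace, ← Finset.mul_sum, mul_comm]

theorem trLeft_kronecker {κ ζ : Type*} [Fintype κ] (P : Matrix κ κ ℂ) (Q : Matrix ζ ζ ℂ) :
    trLeft (P ⊗ₖ Q) = P.trace • Q := by
  ext z z'
  simp [trLeft, Matrix.trace, Finset.sum_mul]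

/-- The Hilbert-Schmidt inner product `⟨P, Q⟩ = Tr (P^* Q)`. -/
def hsInner {ι κ : Type*} [Fintype ι] [Fintype κ] (P Q : Matrix κ ι ℂ) : ℂ :=
  (Pᴴ * Q).trace

section Norms

open scoped MatrixOrder in
/-- The trace norm `‖M‖₁ = Tr √(M^* M)`. -/
def traceNorm {ι κ : Type*} [Fintype ι] [Fintype κ] [DecidableEq ι] (M : Matrix κ ι ℂ) : ℝ :=
  (CFC.sqrt (Mᴴ * M)).trace.re

open scoped Matrix.Norms.L2Operator in
/-- The spectral norm `‖M‖_∞`, the operator norm with respect to the Euclidean norms. -/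
def spectralNorm {ι κ : Type*} [Fintype ι] [Fintype κ] [DecidableEq ι] (M : Matrix κ ι ℂ) : ℝ :=
  ‖M‖

end Norms

/-- Super-operators `L(ℂ^ι) → L(ℂ^κ)`. -/
abbrev SuperOp (ι κ : Type*) := Matrix ι ι ℂ →ₗ[ℂ] Matrix κ κ ℂ

/-- `Φ ⊗ 1_{L(W)}`, where `W = ℂ^ω`: the super-operator `Φ` acts on each of the blocks
of an operator on `X ⊗ W` that are obtained by fixing the two indices in `W`. -/
def tensorId {ι κ : Type*} (Φ : SuperOp ι κ) (ω : Type*) : SuperOp (ι × ω) (κ × ω) where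
  toFun M := Matrix.of fun p q => Φ (Matrix.of fun x x' => M (x, p.2) (x', q.2)) p.1 q.1
  map_add' M N := by
    ext p q
    have h : (Matrix.of fun x x' => (M + N) (x, p.2) (x', q.2)) =
        (Matrix.of fun x x' => M (x, p.2) (x', q.2)) +
          (Matrix.of fun x x' => N (x, p.2) (x', q.2)) := by
      ext; simp
    simp only [Matrix.of_apply, Matrix.add_apply] at h ⊢
    rw [h, map_add, Matrix.add_apply]
  map_smul' c M := by
    ext p q
    have h : (Matrix.of fun x x' => (c • M) (x, p.2) (x', q.2)) =
        c • (Matrix.of fun x x' => M (x, p.2) (x', q.2)) := by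
      ext; simp
    simp only [Matrix.of_apply, Matrix.smul_apply, RingHom.id_apply] at h ⊢
    rw [h, map_smul, Matrix.smul_apply]

/-- The defining property of `Φ ⊗ 1_{L(W)}`. -/
theorem tensorId_kronecker {ι κ ω : Type*} (Φ : SuperOp ι κ) (P : Matrix ι ι ℂ)
    (Q : Matrix ω ω ℂ) : tensorId Φ ω (P ⊗ₖ Q) = Φ P ⊗ₖ Q := by
  ext p q
  have h : (Matrix.of fun x x' => (P ⊗ₖ Q) (x, p.2) (x', q.2)) = Q p.2 q.2 • P := by
    ext; simp [mul_comm]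
  change Φ (Matrix.of fun x x' => (P ⊗ₖ Q) (x, p.2) (x', q.2)) p.1 q.1 = _
  rw [h, map_smul]
  simp [mul_comm]

/-- The norm `‖Φ‖₁ = sup {‖Φ(X)‖₁ : ‖X‖₁ ≤ 1}` of a super-operator. -/
def inducedTraceNorm {ι κ : Type*} [Fintype ι] [Fintype κ] [DecidableEq ι] [DecidableEq κ]
    (Φ : SuperOp ι κ) : ℝ≥0∞ :=
  ⨆ (X : Matrix ι ι ℂ) (_ : traceNorm X ≤ 1), ENNReal.ofReal (traceNorm (Φ X))

/-- The completely bounded trace norm `sup_{k ≥ 1} ‖Φ ⊗ 1_{L(ℂ^k)}‖₁`. -/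
def cbTraceNorm {ι κ : Type*} [Fintype ι] [Fintype κ] [DecidableEq ι] [DecidableEq κ]
    (Φ : SuperOp ι κ) : ℝ≥0∞ :=
  ⨆ (k : ℕ) (_ : 1 ≤ k), inducedTraceNorm (tensorId Φ (Fin k))

/-- The Choi-Jamiolkowski representation `J(Φ) = ∑ i j, Φ(E_{i,j}) ⊗ E_{i,j}`. -/
def choi {ι κ : Type*} [Fintype ι] [DecidableEq ι] (Φ : SuperOp ι κ) :
    Matrix (κ × ι) (κ × ι) ℂ :=
  ∑ i, ∑ j, Φ (Matrix.single i j 1) ⊗ₖ Matrix.single i j (1 : ℂ)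

/-- `(A, B)` is a Stinespring pair for `Φ`: `Φ(X) = Tr_Z (A X B^*)` for all `X`. -/
def IsStinespringPair {ι κ ζ : Type*} [Fintype ι] [Fintype ζ] (Φ : SuperOp ι κ)
    (A B : Matrix (κ × ζ) ι ℂ) : Prop :=
  ∀ X : Matrix ι ι ℂ, Φ X = trRight (A * X * Bᴴ)

/-- Density operators. -/
def IsDensity {ι : Type*} [Fintype ι] (ρ : Matrix ι ι ℂ) : Prop :=
  ρ.PosSemidef ∧ ρ.trace = 1

/-- `(ρ, W)` is feasible for the primal problem. -/
def PrimalFeasible {ι κ ζ : Type*} [Fintype ι] [Fintype κ] [Fintype ζ]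
    (A : Matrix (κ × ζ) ι ℂ) (ρ : Matrix ι ι ℂ) (W : Matrix (κ × ζ) (κ × ζ) ℂ) : Prop :=
  IsDensity ρ ∧ W.PosSemidef ∧ trLeft W = trLeft (A * ρ * Aᴴ)

/-- `Z` is feasible for the dual problem: `Z ≥ 0` and `1 ⊗ Z ≥ B B^*`. -/
def DualFeasible {ι κ ζ : Type*} [Fintype ι] [DecidableEq κ]
    (B : Matrix (κ × ζ) ι ℂ) (Z : Matrix ζ ζ ℂ) : Prop :=
  Z.PosSemidef ∧ ((1 : Matrix κ κ ℂ) ⊗ₖ Z - B * Bᴴ).PosSemidef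

/-- The objective values `⟨B B^*, W⟩` of the feasible points of the primal problem
(the inner product of two positive semidefinite operators is real). -/
def primalValues {ι κ ζ : Type*} [Fintype ι] [Fintype κ] [Fintype ζ]
    (A B : Matrix (κ × ζ) ι ℂ) : Set ℝ :=
  {t | ∃ ρ W, PrimalFeasible A ρ W ∧ t = (hsInner (B * Bᴴ) W).re}

/-- The objective values `‖A^* (1 ⊗ Z) A‖_∞` of the feasible points of the dual problem. -/
def dualValues {ι κ ζ : Type*} [Fintype ι] [Fintype κ] [Fintype ζ]
    [DecidableEq ι] [DecidableEq κ] (A B : Matrix (κ × ζ) ι ℂ) : Set ℝ :=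
  {t | ∃ Z : Matrix ζ ζ ℂ, DualFeasible B Z ∧
    t = spectralNorm (Aᴴ * ((1 : Matrix κ κ ℂ) ⊗ₖ Z) * A)}

end CBTraceNorm

end

/-! Every primal value is at most `|||Φ|||₁²`, which is at most every dual value; a Hahn–Banach
argument closes the gap.

Upper bound: write `X = C Dᴴ` with both squared Hilbert–Schmidt norms at most `‖X‖₁`. Cauchy–Schwarz
gives `‖(Φ ⊗ 1)(X)‖₁ ≤ ‖A‖ ‖B‖` when `‖X‖₁ ≤ 1`. The Stinespring pair may be changed to `(1 ⊗ S)A`,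
`(1 ⊗ S⁻¹)B`; with `S = √(Z + ε)` and `Z` dual feasible, the second operator is a contraction, and
`ε → 0` yields the dual value (`traceNorm_tensorId_sq_le_of_dualFeasible`).

Lower bound: write `ρ = M Mᴴ` and `W = N Nᴴ`. As in Uhlmann's theorem, the primal constraint makes
the reshaped operators `A M` and `N` differ by a partial isometry `U`. Pairing `U` with the image of
a suitable rank-one `X` recovers `√⟨BBᴴ, W⟩` (`primalFeasible_le_cbTraceNorm_sq`).

No gap: if all primal values are `< q`, a compact convex set of constraint defects and shifted
objectives misses a closed ray. The separating functional, normalized, is a dual point of value `<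
q` (`exists_dualFeasible_lt`). Because the inequality is strict, this also gives primal attainment.
-/

noncomputable section

namespace CBTraceNorm

/-! ### Polar decomposition, trace norm and Hilbert–Schmidt estimates -/

section MatrixFacts

variable {ι κ τ : Type*} [Fintype ι] [Fintype κ] [Fintype τ]

open scoped MatrixOrder in
theorem exists_posSemidef_sq [DecidableEq ι] {M : Matrix ι ι ℂ} (hM : M.PosSemidef) :
    ∃ S : Matrix ι ι ℂ, S.PosSemidef ∧ S * S = M :=
  ⟨CFC.sqrt M, nonneg_iff_posSemidef.mp (CFC.sqrt_nonneg M),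
    CFC.sqrt_mul_sqrt_self M (nonneg_iff_posSemidef.mpr hM)⟩

open scoped MatrixOrder in
theorem exists_traceNorm_eq [DecidableEq ι] (M : Matrix κ ι ℂ) :
    ∃ S : Matrix ι ι ℂ, S.PosSemidef ∧ S * S = Mᴴ * M ∧ traceNorm M = S.trace.re :=
  ⟨CFC.sqrt (Mᴴ * M), nonneg_iff_posSemidef.mp (CFC.sqrt_nonneg _),
    CFC.sqrt_mul_sqrt_self _ (nonneg_iff_posSemidef.mpr (posSemidef_conjTranspose_mul_self M)), rfl⟩

/-- Every Hermitian matrix has a Hermitian pseudo-inverse. -/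
theorem exists_pseudoInverse [DecidableEq ι] {G : Matrix ι ι ℂ} (hG : G.IsHermitian) :
    ∃ H : Matrix ι ι ℂ, H.IsHermitian ∧ G * H * G = G ∧ H * G * H = H := by
  obtain ⟨U, d, hUU, rfl⟩ : ∃ (U : Matrix ι ι ℂ) (d : ι → ℝ), Uᴴ * U = 1 ∧
      G = U * diagonal (fun i => (d i : ℂ)) * Uᴴ := by
    refine ⟨hG.eigenvectorUnitary, hG.eigenvalues, ?_, ?_⟩
    · simpa [star_eq_conjTranspose] using Unitary.coe_star_mul_self hG.eigenvectorUnitary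
    · have := hG.spectral_theorem
      rw [Unitary.conjStarAlgAut_apply] at this
      exact this
  have key : ∀ d e f : ι → ℂ, U * diagonal d * Uᴴ * (U * diagonal e * Uᴴ) *
      (U * diagonal f * Uᴴ) = U * diagonal (fun i => d i * e i * f i) * Uᴴ := by
    intro d e f
    calc _ = U * diagonal d * (Uᴴ * U) * diagonal e * (Uᴴ * U) * diagonal f * Uᴴ := by
          simp only [Matrix.mul_assoc]
      _ = _ := by
          rw [hUU, Matrix.mul_one, Matrix.mul_one, Matrix.mul_assoc U, Matrix.mul_assoc U,
            diagonal_mul_diagonal, diagonal_mul_diagonal]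
  -- The convention `0⁻¹ = 0` makes this the inverse on the range and zero on the kernel.
  refine ⟨U * diagonal (fun i => ((d i : ℂ))⁻¹) * Uᴴ, ?_, ?_, ?_⟩
  · refine isHermitian_mul_mul_conjTranspose U (isHermitian_diagonal_of_self_adjoint _ ?_)
    ext i
    simp
  · rw [key]
    simp
  · rw [key]
    congr 3
    ext i
    by_cases h : (d i : ℂ) = 0
    · simp [h]
    · field_simp

section SpectralNorm

open scoped Matrix.Norms.L2Operator

theorem spectralNorm_nonneg [DecidableEq ι] (M : Matrix κ ι ℂ) : 0 ≤ spectralNorm M :=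
  norm_nonneg M

theorem spectralNorm_conjTranspose [DecidableEq ι] [DecidableEq κ] (M : Matrix κ ι ℂ) :
    spectralNorm Mᴴ = spectralNorm M :=
  l2_opNorm_conjTranspose M

theorem spectralNorm_conjTranspose_mul_self [DecidableEq ι] (M : Matrix κ ι ℂ) :
    spectralNorm (Mᴴ * M) = spectralNorm M ^ 2 := by
  rw [sq]
  exact l2_opNorm_conjTranspose_mul_self M

theorem spectralNorm_add_smul_le [DecidableEq ι] (M N : Matrix κ ι ℂ) (c : ℂ) :
    spectralNorm (M + c • N) ≤ spectralNorm M + ‖c‖ * spectralNorm N :=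
  (norm_add_le M (c • N)).trans (by rw [norm_smul]; rfl)

open scoped MatrixOrder in
theorem spectralNorm_le_of_posSemidef [DecidableEq ι] {M : Matrix ι ι ℂ} (hM : M.PosSemidef)
    {c : ℝ} (hc : 0 ≤ c) (h : ((c : ℂ) • (1 : Matrix ι ι ℂ) - M).PosSemidef) :
    spectralNorm M ≤ c := by
  have h0 : (0 : Matrix ι ι ℂ) ≤ M := nonneg_iff_posSemidef.mpr hM
  refine (CStarAlgebra.norm_le_iff_le_algebraMap M hc h0).mpr ?_
  rw [Matrix.le_iff]
  have e : algebraMap ℝ (Matrix ι ι ℂ) c = (c : ℂ) • (1 : Matrix ι ι ℂ) := by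
    rw [Algebra.algebraMap_eq_smul_one]
    ext i j
    simp
  rw [e]
  exact h

theorem sum_norm_sq_mulVec_le [DecidableEq ι] (M : Matrix κ ι ℂ) (x : ι → ℂ) :
    ∑ i, ‖(M *ᵥ x) i‖ ^ 2 ≤ spectralNorm M ^ 2 * ∑ j, ‖x j‖ ^ 2 := by
  have h := l2_opNorm_mulVec M (WithLp.toLp 2 x)
  have h2 := pow_le_pow_left₀ (norm_nonneg _) h 2
  rw [mul_pow, EuclideanSpace.norm_sq_eq, EuclideanSpace.norm_sq_eq] at h2
  exact h2

end SpectralNorm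

/-- The squared Hilbert-Schmidt norm. -/
def hsNormSq (M : Matrix κ ι ℂ) : ℝ := ∑ i, ∑ j, ‖M i j‖ ^ 2

theorem hsNormSq_nonneg (M : Matrix κ ι ℂ) : 0 ≤ hsNormSq M := by
  unfold hsNormSq; positivity

theorem hsNormSq_conjTranspose (M : Matrix κ ι ℂ) : hsNormSq Mᴴ = hsNormSq M := by
  unfold hsNormSq
  rw [Finset.sum_comm]
  simp

theorem trace_conjTranspose_mul_self (M : Matrix κ ι ℂ) : (Mᴴ * M).trace = (hsNormSq M : ℂ) := by
  simp only [Matrix.trace, Matrix.diag, Matrix.mul_apply, hsNormSq, Complex.ofReal_sum,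
    conjTranspose_apply, Complex.ofReal_pow, RCLike.star_def, Complex.conj_mul']
  exact Finset.sum_comm

theorem hsNormSq_mul_le [DecidableEq ι] (M : Matrix κ ι ℂ) (N : Matrix ι τ ℂ) :
    hsNormSq (M * N) ≤ spectralNorm M ^ 2 * hsNormSq N := by
  unfold hsNormSq
  rw [Finset.sum_comm, Finset.sum_comm (f := fun i j => ‖N i j‖ ^ 2), Finset.mul_sum]
  exact Finset.sum_le_sum fun t _ => sum_norm_sq_mulVec_le M fun j => N j t

theorem norm_trace_mul_sq_le (M : Matrix κ ι ℂ) (N : Matrix ι κ ℂ) :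
    ‖(M * N).trace‖ ^ 2 ≤ hsNormSq M * hsNormSq N := by
  have h1 : ‖(M * N).trace‖ ≤ ∑ p : κ × ι, ‖M p.1 p.2‖ * ‖N p.2 p.1‖ := by
    rw [Fintype.sum_prod_type]
    refine (norm_sum_le _ _).trans (Finset.sum_le_sum fun i _ => ?_)
    refine (norm_sum_le _ _).trans (Finset.sum_le_sum fun j _ => ?_)
    rw [norm_mul]
  have h2 := Finset.sum_mul_sq_le_sq_mul_sq (Finset.univ (α := κ × ι))
    (fun p => ‖M p.1 p.2‖) (fun p => ‖N p.2 p.1‖)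
  refine (pow_le_pow_left₀ (norm_nonneg _) h1 2).trans (h2.trans_eq ?_)
  rw [Fintype.sum_prod_type, Fintype.sum_prod_type]
  unfold hsNormSq
  rw [Finset.sum_comm (f := fun i j => ‖N i j‖ ^ 2)]

theorem norm_trace_mul_le {M : Matrix κ ι ℂ} {N : Matrix ι κ ℂ} {c : ℝ}
    (hM : hsNormSq M ≤ c) (hN : hsNormSq N ≤ c) : ‖(M * N).trace‖ ≤ c := by
  have hc := (hsNormSq_nonneg M).trans hM
  refine abs_le_of_sq_le_sq' ?_ hc |>.2
  calc _ ≤ _ := norm_trace_mul_sq_le M N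
    _ ≤ c * c := mul_le_mul hM hN (hsNormSq_nonneg N) hc
    _ = c ^ 2 := (sq c).symm

/-- `H * G` acts as the identity on the right of `R`: the Gram matrix of `R * H * G - R` is `(G * H
* G - G) * (H * G - 1) = 0`. -/
theorem mul_pseudoInverse_mul_gram [DecidableEq ι] {G H : Matrix ι ι ℂ} (hH : H.IsHermitian)
    (hG : G * H * G = G) {R : Matrix κ ι ℂ} (hR : Rᴴ * R = G) : R * H * G = R := by
  have hGh : Gᴴ = G := hR ▸ isHermitian_conjTranspose_mul_self R
  rw [← sub_eq_zero, ← conjTranspose_mul_self_eq_zero]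
  have e : (R * H * G - R)ᴴ = G * H * Rᴴ - Rᴴ := by
    simp only [conjTranspose_sub, conjTranspose_mul, hH.eq, hGh, Matrix.mul_assoc]
  calc _ = (G * H * (Rᴴ * R) - Rᴴ * R) * (H * G - 1) := by
        rw [e]
        simp only [Matrix.mul_sub, Matrix.sub_mul, Matrix.mul_assoc, Matrix.mul_one]
    _ = 0 := by rw [hR, hG, sub_self, Matrix.zero_mul]

/-- Two matrices with the same Gram matrix differ by a partial isometry. -/
theorem exists_partialIsometry [DecidableEq ι] [DecidableEq τ] {P : Matrix κ ι ℂ}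
    {Q : Matrix τ ι ℂ} (h : Pᴴ * P = Qᴴ * Q) :
    ∃ V : Matrix κ τ ℂ, V * Q = P ∧ Vᴴ * P = Q ∧ spectralNorm V ≤ 1 := by
  obtain ⟨H, hH, hG, hHG⟩ := exists_pseudoInverse (isHermitian_conjTranspose_mul_self P)
  have e : (P * H * Qᴴ)ᴴ = Q * H * Pᴴ := by
    simp only [conjTranspose_mul, hH.eq, conjTranspose_conjTranspose, Matrix.mul_assoc]
  refine ⟨P * H * Qᴴ, ?_, ?_, ?_⟩
  · rw [Matrix.mul_assoc, ← h, mul_pseudoInverse_mul_gram hH hG rfl]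
  · rw [e, Matrix.mul_assoc, mul_pseudoInverse_mul_gram hH hG h.symm]
  -- With `V = P * H * Qᴴ`, `Vᴴ * V = Q * H * Qᴴ` is a Hermitian idempotent. Its norm therefore
  -- equals its own square, which rules out `‖V‖ > 1`.
  · have h1 : (P * H * Qᴴ)ᴴ * (P * H * Qᴴ) = Q * H * Qᴴ := by
      calc _ = Q * (H * (Pᴴ * P) * H) * Qᴴ := by rw [e]; simp only [Matrix.mul_assoc]
        _ = _ := by rw [hHG]
    have h2 : (Q * H * Qᴴ)ᴴ * (Q * H * Qᴴ) = Q * H * Qᴴ := by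
      calc _ = Q * (H * (Qᴴ * Q) * H) * Qᴴ := by
            simp only [conjTranspose_mul, hH.eq, conjTranspose_conjTranspose, Matrix.mul_assoc]
        _ = _ := by rw [← h, hHG]
    have h3 := spectralNorm_conjTranspose_mul_self (Q * H * Qᴴ)
    have h4 := spectralNorm_conjTranspose_mul_self (P * H * Qᴴ)
    rw [h2] at h3
    rw [h1] at h4
    by_contra! hlt
    have h5 : 1 < spectralNorm (Q * H * Qᴴ) := h4 ▸ one_lt_pow₀ hlt two_ne_zero
    nlinarith

/-- Polar decomposition, with the modulus written as `Rᴴ * R`. -/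
theorem exists_polar [DecidableEq ι] (M : Matrix κ ι ℂ) :
    ∃ (V : Matrix κ ι ℂ) (R : Matrix ι ι ℂ), spectralNorm V ≤ 1 ∧ M = V * (Rᴴ * R) ∧
      Vᴴ * M = Rᴴ * R ∧ traceNorm M = hsNormSq R := by
  obtain ⟨S, hS, hSM, htr⟩ := exists_traceNorm_eq M
  obtain ⟨R, hR, hRS⟩ := exists_posSemidef_sq hS
  have hRR : Rᴴ * R = S := by rw [hR.1.eq, hRS]
  obtain ⟨V, hV1, hV2, hV⟩ := exists_partialIsometry (P := M) (Q := S) (by rw [hS.1.eq, hSM])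
  refine ⟨V, R, hV, by rw [hRR, hV1], by rw [hRR, hV2], ?_⟩
  rw [htr, ← hRR, trace_conjTranspose_mul_self, Complex.ofReal_re]

theorem traceNorm_nonneg [DecidableEq ι] (M : Matrix κ ι ℂ) : 0 ≤ traceNorm M := by
  obtain ⟨V, R, -, -, -, h⟩ := exists_polar M
  exact h ▸ hsNormSq_nonneg R

theorem hsNormSq_mul_le_of_contraction [DecidableEq ι] {M : Matrix κ ι ℂ}
    (hM : spectralNorm M ≤ 1) (N : Matrix ι τ ℂ) : hsNormSq (M * N) ≤ hsNormSq N := by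
  refine (hsNormSq_mul_le M N).trans (mul_le_of_le_one_left (hsNormSq_nonneg N) ?_)
  exact pow_le_one₀ (spectralNorm_nonneg M) hM

theorem norm_trace_mul_le_traceNorm [DecidableEq ι] [DecidableEq κ] {U : Matrix ι κ ℂ}
    (hU : spectralNorm U ≤ 1) (M : Matrix κ ι ℂ) : ‖(U * M).trace‖ ≤ traceNorm M := by
  obtain ⟨V, R, hV, hM, -, htr⟩ := exists_polar M
  have : (U * M).trace = (R * (U * (V * Rᴴ))).trace := by
    rw [hM, Matrix.trace_mul_comm R]
    simp only [Matrix.mul_assoc]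
  rw [this, htr]
  refine norm_trace_mul_le le_rfl ?_
  refine (hsNormSq_mul_le_of_contraction hU _).trans ?_
  exact (hsNormSq_mul_le_of_contraction hV _).trans (hsNormSq_conjTranspose R).le

/-- Duality of the trace norm and the spectral norm, applied to a product. -/
theorem traceNorm_mul_conjTranspose_sq_le [DecidableEq ι] [DecidableEq κ] (C : Matrix κ τ ℂ)
    (D : Matrix ι τ ℂ) : traceNorm (C * Dᴴ) ^ 2 ≤ hsNormSq C * hsNormSq D := by
  obtain ⟨V, R, hV, -, hVM, htr⟩ := exists_polar (C * Dᴴ)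
  have h1 : ((Vᴴ * C) * Dᴴ).trace = (traceNorm (C * Dᴴ) : ℂ) := by
    rw [Matrix.mul_assoc, hVM, htr, trace_conjTranspose_mul_self]
  have h2 := norm_trace_mul_sq_le (Vᴴ * C) Dᴴ
  rw [h1, Complex.norm_real, Real.norm_eq_abs, sq_abs, hsNormSq_conjTranspose D] at h2
  refine h2.trans (mul_le_mul_of_nonneg_right ?_ (hsNormSq_nonneg D))
  exact hsNormSq_mul_le_of_contraction (by rwa [spectralNorm_conjTranspose]) C

/-- A matrix is the product of two factors whose squared Hilbert-Schmidt norms are at most its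
trace norm. -/
theorem exists_factorization [DecidableEq ι] (M : Matrix κ ι ℂ) :
    ∃ (C : Matrix κ ι ℂ) (D : Matrix ι ι ℂ), M = C * Dᴴ ∧ hsNormSq C ≤ traceNorm M ∧
      hsNormSq D ≤ traceNorm M := by
  obtain ⟨V, R, hV, hM, -, htr⟩ := exists_polar M
  refine ⟨V * Rᴴ, Rᴴ, ?_, ?_, ?_⟩
  · rw [conjTranspose_conjTranspose, Matrix.mul_assoc, ← hM]
  · exact (hsNormSq_mul_le_of_contraction hV _).trans (by rw [hsNormSq_conjTranspose, htr])
  · rw [hsNormSq_conjTranspose, htr]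

end MatrixFacts

/-! ### Weak duality: dual values dominate the completely bounded norm -/

section Dilation

variable {ι κ ζ ω τ : Type*} [Fintype ι] [Fintype κ] [Fintype ζ] [Fintype ω] [Fintype τ]

set_option linter.unusedSectionVars false

/-- The block of an operator into `X ⊗ W` with a fixed index in `W`. -/
def rowBlock (C : Matrix (ι × ω) τ ℂ) (w : ω) : Matrix ι τ ℂ := Matrix.of fun x t => C (x, w) t

/-- The operator `(A ⊗ 1) C`, with the factor `Z` moved to the input side. -/
def dilate (A : Matrix (κ × ζ) ι ℂ) (C : Matrix (ι × ω) τ ℂ) : Matrix (κ × ω) (ζ × τ) ℂ :=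
  Matrix.of fun p q => (A * rowBlock C p.2) (p.1, q.1) q.2

/-- With `Z` on the input side, the partial trace over `Z` becomes part of the summation in a matrix
product, so the Hilbert–Schmidt bound for products applies to `Φ ⊗ 1`. -/
theorem tensorId_mul_conjTranspose {Φ : SuperOp ι κ} {A B : Matrix (κ × ζ) ι ℂ}
    (h : IsStinespringPair Φ A B) (C D : Matrix (ι × ω) τ ℂ) :
    tensorId Φ ω (C * Dᴴ) = dilate A C * (dilate B D)ᴴ := by
  ext p q
  have e : (Matrix.of fun x x' => (C * Dᴴ) (x, p.2) (x', q.2)) =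
      rowBlock C p.2 * (rowBlock D q.2)ᴴ := rfl
  change Φ (Matrix.of fun x x' => (C * Dᴴ) (x, p.2) (x', q.2)) p.1 q.1 = _
  have e2 : A * (rowBlock C p.2 * (rowBlock D q.2)ᴴ) * Bᴴ =
      (A * rowBlock C p.2) * (B * rowBlock D q.2)ᴴ := by
    simp only [conjTranspose_mul, Matrix.mul_assoc]
  rw [e, h, e2, Matrix.mul_apply, Fintype.sum_prod_type]
  rfl

theorem hsNormSq_eq_sum_rowBlock (C : Matrix (ι × ω) τ ℂ) :
    hsNormSq C = ∑ w, hsNormSq (rowBlock C w) := by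
  unfold hsNormSq
  rw [Fintype.sum_prod_type, Finset.sum_comm]
  rfl

theorem hsNormSq_dilate (A : Matrix (κ × ζ) ι ℂ) (C : Matrix (ι × ω) τ ℂ) :
    hsNormSq (dilate A C) = ∑ w, hsNormSq (A * rowBlock C w) := by
  unfold hsNormSq
  rw [Fintype.sum_prod_type, Finset.sum_comm]
  simp only [Fintype.sum_prod_type]
  rfl

theorem hsNormSq_dilate_le [DecidableEq ι] (A : Matrix (κ × ζ) ι ℂ) (C : Matrix (ι × ω) τ ℂ) :
    hsNormSq (dilate A C) ≤ spectralNorm A ^ 2 * hsNormSq C := by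
  rw [hsNormSq_dilate, hsNormSq_eq_sum_rowBlock, Finset.mul_sum]
  exact Finset.sum_le_sum fun w _ => hsNormSq_mul_le A _

theorem traceNorm_tensorId_sq_le [DecidableEq ι] [DecidableEq κ] [DecidableEq ω]
    {Φ : SuperOp ι κ} {A B : Matrix (κ × ζ) ι ℂ} (h : IsStinespringPair Φ A B)
    {X : Matrix (ι × ω) (ι × ω) ℂ} (hX : traceNorm X ≤ 1) :
    traceNorm (tensorId Φ ω X) ^ 2 ≤ spectralNorm A ^ 2 * spectralNorm B ^ 2 := by
  obtain ⟨C, D, rfl, hC, hD⟩ := exists_factorization X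
  rw [tensorId_mul_conjTranspose h]
  refine (traceNorm_mul_conjTranspose_sq_le _ _).trans ?_
  refine mul_le_mul ?_ ?_ (hsNormSq_nonneg _) (by positivity)
  · exact (hsNormSq_dilate_le A C).trans (mul_le_of_le_one_right (by positivity) (hC.trans hX))
  · exact (hsNormSq_dilate_le B D).trans (mul_le_of_le_one_right (by positivity) (hD.trans hX))

theorem trRight_one_kronecker_mul [DecidableEq κ] (R : Matrix ζ ζ ℂ)
    (M : Matrix (κ × ζ) (κ × ζ) ℂ) :
    trRight (((1 : Matrix κ κ ℂ) ⊗ₖ R) * M) = trRight (M * ((1 : Matrix κ κ ℂ) ⊗ₖ R)) := by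
  ext y y'
  simp only [trRight, of_apply, Matrix.mul_apply, Fintype.sum_prod_type, kroneckerMap_apply,
    Matrix.one_apply, ite_mul, one_mul, zero_mul, mul_ite, mul_zero]
  simp only [Finset.sum_ite_irrel, Finset.sum_const_zero, Finset.sum_ite_eq, Finset.sum_ite_eq',
    Finset.mem_univ, if_true]
  rw [Finset.sum_comm]
  simp only [mul_comm]

/-- Operators on `Z` alone can be cycled under `Tr_Z`. This freedom in the Stinespring pair is what
the dual variable optimizes over. -/
theorem IsStinespringPair.gauge [DecidableEq κ] [DecidableEq ζ] {Φ : SuperOp ι κ}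
    {A B : Matrix (κ × ζ) ι ℂ} (h : IsStinespringPair Φ A B) {R R' : Matrix ζ ζ ℂ}
    (hR : R' * R = 1) :
    IsStinespringPair Φ (((1 : Matrix κ κ ℂ) ⊗ₖ R) * A) (((1 : Matrix κ κ ℂ) ⊗ₖ R')ᴴ * B) := by
  intro X
  have e : ((1 : Matrix κ κ ℂ) ⊗ₖ R) * A * X * (((1 : Matrix κ κ ℂ) ⊗ₖ R')ᴴ * B)ᴴ =
      ((1 : Matrix κ κ ℂ) ⊗ₖ R) * (A * X * Bᴴ * ((1 : Matrix κ κ ℂ) ⊗ₖ R')) := by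
    simp only [conjTranspose_mul, conjTranspose_conjTranspose, Matrix.mul_assoc]
  rw [e, trRight_one_kronecker_mul, Matrix.mul_assoc _ (_ ⊗ₖ R'), ← mul_kronecker_mul, hR,
    Matrix.one_mul, one_kronecker_one, Matrix.mul_one]
  exact h X

/-- Change the pair by `S = √(Z + ε)`, where `ε` ensures invertibility. Since `B Bᴴ ≤ 1 ⊗ (Z + ε)`,
the operator `(1 ⊗ S⁻¹) B` is a contraction, and only `‖(1 ⊗ S) A‖²` remains. -/
theorem traceNorm_tensorId_sq_le_of_dualFeasible_add [DecidableEq ι] [DecidableEq κ]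
    [DecidableEq ζ] [DecidableEq ω] {Φ : SuperOp ι κ} {A B : Matrix (κ × ζ) ι ℂ}
    (h : IsStinespringPair Φ A B) {Z : Matrix ζ ζ ℂ} (hZ : DualFeasible B Z)
    {X : Matrix (ι × ω) (ι × ω) ℂ} (hX : traceNorm X ≤ 1) {ε : ℝ} (hε : 0 < ε) :
    traceNorm (tensorId Φ ω X) ^ 2 ≤
      spectralNorm (Aᴴ * ((1 : Matrix κ κ ℂ) ⊗ₖ Z) * A) + ε * spectralNorm (Aᴴ * A) := by
  have hεZ : (Z + (ε : ℂ) • (1 : Matrix ζ ζ ℂ)).PosDef :=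
    PosDef.posSemidef_add hZ.1 (PosDef.one.smul (by exact_mod_cast hε))
  obtain ⟨S, hS, hSS⟩ := exists_posSemidef_sq hεZ.posSemidef
  have hSu : IsUnit S.det := by
    have := (Matrix.isUnit_iff_isUnit_det _).mp hεZ.isUnit
    rw [← hSS, det_mul] at this
    exact isUnit_of_mul_isUnit_left this
  have hkS : ((1 : Matrix κ κ ℂ) ⊗ₖ S)ᴴ = (1 : Matrix κ κ ℂ) ⊗ₖ S := by
    rw [conjTranspose_kronecker, conjTranspose_one, hS.1.eq]
  have hkSS : ((1 : Matrix κ κ ℂ) ⊗ₖ S) * ((1 : Matrix κ κ ℂ) ⊗ₖ S) =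
      (1 : Matrix κ κ ℂ) ⊗ₖ Z + (ε : ℂ) • (1 : Matrix (κ × ζ) (κ × ζ) ℂ) := by
    rw [← mul_kronecker_mul, hSS, Matrix.one_mul, kronecker_add, kronecker_smul,
      one_kronecker_one]
  set T := (1 : Matrix κ κ ℂ) ⊗ₖ S⁻¹ with hT
  have hTS : T * ((1 : Matrix κ κ ℂ) ⊗ₖ S) = 1 := by
    rw [hT, ← mul_kronecker_mul, Matrix.one_mul, Matrix.nonsing_inv_mul _ hSu, one_kronecker_one]
  have hTh : Tᴴ = T := by
    rw [hT, conjTranspose_kronecker, conjTranspose_one, hS.inv.1.eq]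
  have hST : ((1 : Matrix κ κ ℂ) ⊗ₖ S) * T = 1 := mul_eq_one_comm.mp hTS
  have h1 := traceNorm_tensorId_sq_le (h.gauge (Matrix.nonsing_inv_mul _ hSu)) hX
  have hA : spectralNorm (((1 : Matrix κ κ ℂ) ⊗ₖ S) * A) ^ 2 ≤
      spectralNorm (Aᴴ * ((1 : Matrix κ κ ℂ) ⊗ₖ Z) * A) + ε * spectralNorm (Aᴴ * A) := by
    have e : (((1 : Matrix κ κ ℂ) ⊗ₖ S) * A)ᴴ * (((1 : Matrix κ κ ℂ) ⊗ₖ S) * A) =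
        Aᴴ * ((1 : Matrix κ κ ℂ) ⊗ₖ Z) * A + (ε : ℂ) • (Aᴴ * A) := by
      calc _ = Aᴴ * (((1 : Matrix κ κ ℂ) ⊗ₖ S) * ((1 : Matrix κ κ ℂ) ⊗ₖ S)) * A := by
            rw [conjTranspose_mul, hkS]; simp only [Matrix.mul_assoc]
        _ = _ := by
            rw [hkSS, Matrix.mul_add, Matrix.add_mul, Matrix.mul_smul, Matrix.smul_mul,
              Matrix.mul_one]
    rw [← spectralNorm_conjTranspose_mul_self, e]
    refine (spectralNorm_add_smul_le _ _ _).trans_eq ?_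
    rw [Complex.norm_real, Real.norm_eq_abs, abs_of_pos hε]
  have hB : spectralNorm (Tᴴ * B) ^ 2 ≤ 1 := by
    have e : (1 : Matrix (κ × ζ) (κ × ζ) ℂ) - (T * B) * (T * B)ᴴ =
        T * (((1 : Matrix κ κ ℂ) ⊗ₖ Z - B * Bᴴ) + (ε : ℂ) • 1) * Tᴴ := by
      calc _ = T * (((1 : Matrix κ κ ℂ) ⊗ₖ S) * ((1 : Matrix κ κ ℂ) ⊗ₖ S) - B * Bᴴ) * T := by
            rw [Matrix.mul_sub, Matrix.sub_mul, ← Matrix.mul_assoc T, hTS, Matrix.one_mul, hST,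
              conjTranspose_mul, hTh]
            simp only [Matrix.mul_assoc]
        _ = _ := by rw [hkSS, hTh]; congr 2; abel
    have hpos : ((1 : Matrix (κ × ζ) (κ × ζ) ℂ) - (T * B) * (T * B)ᴴ).PosSemidef := by
      rw [e]
      refine PosSemidef.mul_mul_conjTranspose_same (hZ.2.add ?_) T
      exact PosSemidef.one.smul (by exact_mod_cast hε.le)
    rw [hTh, ← spectralNorm_conjTranspose (T * B), ← spectralNorm_conjTranspose_mul_self,
      conjTranspose_conjTranspose]
    exact spectralNorm_le_of_posSemidef (posSemidef_self_mul_conjTranspose _) zero_le_one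
      (by simpa using hpos)
  calc _ ≤ _ := h1
    _ ≤ spectralNorm (((1 : Matrix κ κ ℂ) ⊗ₖ S) * A) ^ 2 * 1 :=
        mul_le_mul_of_nonneg_left hB (sq_nonneg _)
    _ ≤ _ := by rw [mul_one]; exact hA

/-- Weak duality. -/
theorem traceNorm_tensorId_sq_le_of_dualFeasible [DecidableEq ι] [DecidableEq κ]
    [DecidableEq ζ] [DecidableEq ω] {Φ : SuperOp ι κ} {A B : Matrix (κ × ζ) ι ℂ}
    (h : IsStinespringPair Φ A B) {Z : Matrix ζ ζ ℂ} (hZ : DualFeasible B Z)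
    {X : Matrix (ι × ω) (ι × ω) ℂ} (hX : traceNorm X ≤ 1) :
    traceNorm (tensorId Φ ω X) ^ 2 ≤
      spectralNorm (Aᴴ * ((1 : Matrix κ κ ℂ) ⊗ₖ Z) * A) := by
  refine le_of_forall_pos_le_add fun δ hδ => ?_
  have hs := spectralNorm_nonneg (Aᴴ * A)
  refine (traceNorm_tensorId_sq_le_of_dualFeasible_add h hZ hX
    (ε := δ / (spectralNorm (Aᴴ * A) + 1)) (by positivity)).trans ?_
  gcongr
  rw [div_mul_eq_mul_div, div_le_iff₀ (by positivity)]
  nlinarith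

theorem cbTraceNorm_le_of_dualFeasible [DecidableEq ι] [DecidableEq κ] [DecidableEq ζ]
    {Φ : SuperOp ι κ} {A B : Matrix (κ × ζ) ι ℂ} (h : IsStinespringPair Φ A B)
    {Z : Matrix ζ ζ ℂ} (hZ : DualFeasible B Z) :
    cbTraceNorm Φ ≤
      ENNReal.ofReal (√(spectralNorm (Aᴴ * ((1 : Matrix κ κ ℂ) ⊗ₖ Z) * A))) :=
  iSup₂_le fun _ _ => iSup₂_le fun _ hX => ENNReal.ofReal_le_ofReal
    (Real.le_sqrt_of_sq_le (traceNorm_tensorId_sq_le_of_dualFeasible h hZ hX))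

theorem cbTraceNorm_toReal_sq_le [DecidableEq ι] [DecidableEq κ] [DecidableEq ζ]
    {Φ : SuperOp ι κ} {A B : Matrix (κ × ζ) ι ℂ} (h : IsStinespringPair Φ A B)
    {Z : Matrix ζ ζ ℂ} (hZ : DualFeasible B Z) :
    (cbTraceNorm Φ).toReal ^ 2 ≤ spectralNorm (Aᴴ * ((1 : Matrix κ κ ℂ) ⊗ₖ Z) * A) := by
  refine (Real.le_sqrt ENNReal.toReal_nonneg (spectralNorm_nonneg _)).mp ?_
  exact ENNReal.toReal_le_of_le_ofReal (Real.sqrt_nonneg _) (cbTraceNorm_le_of_dualFeasible h hZ)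

theorem traceNorm_tensorId_le_cbTraceNorm [DecidableEq ι] [DecidableEq κ] {Φ : SuperOp ι κ}
    (hΦ : cbTraceNorm Φ ≠ ⊤) {k : ℕ} (hk : 1 ≤ k) {X : Matrix (ι × Fin k) (ι × Fin k) ℂ}
    (hX : traceNorm X ≤ 1) : traceNorm (tensorId Φ (Fin k) X) ≤ (cbTraceNorm Φ).toReal := by
  refine (ENNReal.ofReal_le_iff_le_toReal hΦ).mp ?_
  exact (le_iSup₂_of_le (f := fun (X : Matrix (ι × Fin k) (ι × Fin k) ℂ) (_ : traceNorm X ≤ 1) =>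
      ENNReal.ofReal (traceNorm (tensorId Φ (Fin k) X))) X hX le_rfl).trans
    (le_iSup₂_of_le (f := fun (k : ℕ) (_ : 1 ≤ k) => inducedTraceNorm (tensorId Φ (Fin k)))
      k hk le_rfl)

/-! ### Primal values are dominated by the completely bounded norm -/

/-- The square root is padded so that `ρ` and `W`, of different sizes, can be factored through one
ancilla `ℂ^k`. -/
theorem exists_mul_conjTranspose_eq [DecidableEq ι] {ρ : Matrix ι ι ℂ} (hρ : ρ.PosSemidef)
    {k : ℕ} (hk : Fintype.card ι ≤ k) : ∃ M : Matrix ι (Fin k) ℂ, M * Mᴴ = ρ := by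
  obtain ⟨S, hS, hSS⟩ := exists_posSemidef_sq hρ
  obtain ⟨f⟩ : Nonempty (ι ↪ Fin k) :=
    Function.Embedding.nonempty_of_card_le (by simpa using hk)
  set E : Matrix ι (Fin k) ℂ := Matrix.of fun i j => if f i = j then 1 else 0 with hE
  have hEE : E * Eᴴ = 1 := by
    ext i j
    simp [hE, Matrix.mul_apply, Matrix.one_apply, apply_ite, f.injective.eq_iff, eq_comm]
  refine ⟨S * E, ?_⟩
  rw [conjTranspose_mul, Matrix.mul_assoc, ← Matrix.mul_assoc E, hEE, Matrix.one_mul, hS.1.eq, hSS]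

/-- An operator `W → Y ⊗ Z` as an operator `Z → Y ⊗ W`. -/
def reshape (N : Matrix (κ × ζ) ω ℂ) : Matrix (κ × ω) (ζ × Unit) ℂ :=
  Matrix.of fun p q => N (p.1, q.1) p.2

/-- An operator `W → X` as a vector in `X ⊗ W`. -/
def vectorize (M : Matrix ι ω ℂ) : Matrix (ι × ω) Unit ℂ := Matrix.of fun p _ => M p.1 p.2

theorem dilate_vectorize (A : Matrix (κ × ζ) ι ℂ) (M : Matrix ι ω ℂ) :
    dilate A (vectorize M) = reshape (A * M) := rfl

theorem hsNormSq_vectorize (M : Matrix ι ω ℂ) : hsNormSq (vectorize M) = hsNormSq M := by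
  simp [hsNormSq, vectorize, Fintype.sum_prod_type]

theorem trace_reshape_mul_conjTranspose (N N' : Matrix (κ × ζ) ω ℂ) :
    (reshape N * (reshape N')ᴴ).trace = (N * N'ᴴ).trace := by
  simp only [Matrix.trace, Matrix.diag, Matrix.mul_apply, Fintype.sum_prod_type, reshape,
    of_apply, conjTranspose_apply, Finset.univ_unique, Finset.sum_singleton]
  exact Finset.sum_congr rfl fun _ _ => Finset.sum_comm

/-- The Gram matrix of a reshaped operator is the transpose of a partial trace, so the primal
constraint becomes an equality of Gram matrices. -/
theorem conjTranspose_reshape_mul_self (N : Matrix (κ × ζ) ω ℂ) :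
    (reshape N)ᴴ * reshape N =
      Matrix.of fun p q => trLeft (N * Nᴴ) q.1 p.1 := by
  ext p q
  simp only [Matrix.mul_apply, Fintype.sum_prod_type, reshape, of_apply, conjTranspose_apply,
    trLeft, mul_comm]

/-- Every primal feasible value is at most the square of the completely bounded trace norm. -/
theorem primalFeasible_le_cbTraceNorm_sq [DecidableEq ι] [DecidableEq κ] [DecidableEq ζ]
    {Φ : SuperOp ι κ} (hΦ : cbTraceNorm Φ ≠ ⊤) {A B : Matrix (κ × ζ) ι ℂ}
    (h : IsStinespringPair Φ A B) {ρ : Matrix ι ι ℂ} {W : Matrix (κ × ζ) (κ × ζ) ℂ}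
    (hρW : PrimalFeasible A ρ W) :
    (hsInner (B * Bᴴ) W).re ≤ (cbTraceNorm Φ).toReal ^ 2 := by
  obtain ⟨⟨hρ, htr⟩, hW, hAρ⟩ := hρW
  -- Large enough for both factorizations; the `+ 1` gives `1 ≤ k`.
  set k := Fintype.card ι + Fintype.card (κ × ζ) + 1
  obtain ⟨M, rfl⟩ := exists_mul_conjTranspose_eq hρ (k := k) (by omega)
  obtain ⟨N, rfl⟩ := exists_mul_conjTranspose_eq hW (k := k) (by omega)
  have hM : hsNormSq M = 1 := by
    rw [← hsNormSq_conjTranspose, ← Complex.ofReal_inj, ← trace_conjTranspose_mul_self,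
      conjTranspose_conjTranspose, htr, Complex.ofReal_one]
  have hval : (N * (B * (Bᴴ * N))ᴴ).trace = (hsNormSq (Bᴴ * N) : ℂ) := by
    rw [← trace_conjTranspose_mul_self, conjTranspose_mul, ← Matrix.mul_assoc,
      Matrix.trace_mul_comm, ← Matrix.mul_assoc, Matrix.trace_mul_comm]
  have hobj : (hsInner (B * Bᴴ) (N * Nᴴ)).re = hsNormSq (Bᴴ * N) := by
    rw [← Complex.ofReal_re (hsNormSq (Bᴴ * N)), ← hval, hsInner, Matrix.trace_mul_comm]
    simp only [conjTranspose_mul, conjTranspose_conjTranspose, Matrix.mul_assoc]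
  rw [hobj]
  set s := hsNormSq (Bᴴ * N) with hs
  have hs0 : 0 ≤ s := hsNormSq_nonneg _
  rcases hs0.eq_or_lt with h0 | h0
  · rw [← h0]; positivity
  obtain ⟨U, hU, -, hU1⟩ := exists_partialIsometry (P := reshape N) (Q := reshape (A * M)) (by
    rw [conjTranspose_reshape_mul_self, conjTranspose_reshape_mul_self, hAρ, conjTranspose_mul]
    simp only [Matrix.mul_assoc])
  -- This scaling gives `c • vectorize (Bᴴ * N)` unit norm, so `‖X‖₁ ≤ 1`, while the pairing with
  -- `U` equals `c * s = √s`.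
  set c : ℝ := (√s)⁻¹ with hc
  set X := vectorize M * ((c : ℂ) • vectorize (Bᴴ * N))ᴴ with hXdef
  have hcs : c * s = √s := by
    rw [hc, inv_mul_eq_div, Real.div_sqrt]
  have hX : traceNorm X ≤ 1 := by
    have h1 := traceNorm_mul_conjTranspose_sq_le (vectorize M) ((c : ℂ) • vectorize (Bᴴ * N))
    have h2 : hsNormSq ((c : ℂ) • vectorize (Bᴴ * N)) = c ^ 2 * s := by
      rw [hs, ← hsNormSq_vectorize (Bᴴ * N)]
      simp [hsNormSq, mul_pow, Finset.mul_sum]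
    have h3 : c ^ 2 * s = 1 := by
      rw [hc, inv_pow, Real.sq_sqrt hs0, inv_mul_cancel₀ h0.ne']
    rw [h2, h3, hsNormSq_vectorize, hM, mul_one] at h1
    exact (sq_le_one_iff₀ (traceNorm_nonneg _)).mp h1
  have hUX : (U * tensorId Φ (Fin k) X).trace = ((√s : ℝ) : ℂ) := by
    rw [hXdef, conjTranspose_smul, Matrix.mul_smul, map_smul, tensorId_mul_conjTranspose h,
      dilate_vectorize, dilate_vectorize, Matrix.mul_smul, ← Matrix.mul_assoc, hU, trace_smul,
      trace_reshape_mul_conjTranspose, hval, ← hcs]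
    simp
  have h4 := norm_trace_mul_le_traceNorm hU1 (tensorId Φ (Fin k) X)
  rw [hUX, Complex.norm_real, Real.norm_eq_abs, abs_of_nonneg (Real.sqrt_nonneg s)] at h4
  have h5 := h4.trans (traceNorm_tensorId_le_cbTraceNorm hΦ (by omega) hX)
  calc s = √s ^ 2 := (Real.sq_sqrt hs0).symm
    _ ≤ _ := pow_le_pow_left₀ (Real.sqrt_nonneg s) h5 2

end Dilation

/-! ### The positive semidefinite cone: compactness and functionals -/

section Separation

variable {ι κ ζ : Type*} [Fintype ι] [Fintype κ] [Fintype ζ]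

set_option linter.unusedSectionVars false

theorem posSemidef_iff_re {M : Matrix ι ι ℂ} :
    M.PosSemidef ↔ M.IsHermitian ∧ ∀ x : ι → ℂ, 0 ≤ (star x ⬝ᵥ (M *ᵥ x)).re := by
  rw [posSemidef_iff_dotProduct_mulVec]
  refine and_congr_right fun hM => forall_congr' fun x => ?_
  rw [Complex.nonneg_iff, and_iff_left]
  exact (hM.im_star_dotProduct_mulVec_self x).symm

/-- Self-duality of the cone, tested on the rank-one operators `x xᴴ`. -/
theorem posSemidef_of_trace_mul_nonneg {M : Matrix ι ι ℂ} (hM : M.IsHermitian)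
    (h : ∀ P : Matrix ι ι ℂ, P.PosSemidef → 0 ≤ (M * P).trace.re) : M.PosSemidef := by
  refine posSemidef_iff_re.mpr ⟨hM, fun x => ?_⟩
  have := h _ (posSemidef_vecMulVec_self_star x)
  rwa [mul_vecMulVec, trace_vecMulVec, dotProduct_comm] at this

theorem isClosed_posSemidef : IsClosed {M : Matrix ι ι ℂ | M.PosSemidef} := by
  simp only [posSemidef_iff_re, Set.ofPred_and, Set.ofPred_forall]
  refine IsClosed.inter (isClosed_eq (by fun_prop) continuous_id) (isClosed_iInter fun x => ?_)
  refine isClosed_le continuous_const (Complex.continuous_re.comp ?_)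
  exact Continuous.dotProduct continuous_const (continuous_id.matrix_mulVec continuous_const)

theorem norm_apply_le_trace_re {M : Matrix ι ι ℂ} (hM : M.PosSemidef) (i j : ι) :
    ‖M i j‖ ≤ M.trace.re := by
  classical
  obtain ⟨R, hR, rfl⟩ := exists_posSemidef_sq hM
  have htr : (R * R).trace.re = hsNormSq R := by
    rw [← Complex.ofReal_re (hsNormSq R), ← trace_conjTranspose_mul_self, hR.1.eq]
  have hcol : ∀ j, ∑ k, ‖R k j‖ ^ 2 ≤ hsNormSq R := fun j =>
    Finset.sum_le_sum fun k _ => Finset.single_le_sum (f := fun j => ‖R k j‖ ^ 2)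
      (fun _ _ => sq_nonneg _) (Finset.mem_univ j)
  have hrow : ∀ i, ∑ k, ‖R i k‖ ^ 2 ≤ hsNormSq R := fun i =>
    Finset.single_le_sum (f := fun i => ∑ k, ‖R i k‖ ^ 2)
      (fun _ _ => Finset.sum_nonneg fun _ _ => sq_nonneg _) (Finset.mem_univ i)
  rw [htr, Matrix.mul_apply]
  calc _ ≤ ∑ k, ‖R i k‖ * ‖R k j‖ := (norm_sum_le _ _).trans_eq (by simp)
    _ ≤ ∑ k, (‖R i k‖ ^ 2 + ‖R k j‖ ^ 2) / 2 :=
        Finset.sum_le_sum fun k _ => by nlinarith [sq_nonneg (‖R i k‖ - ‖R k j‖)]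
    _ = (∑ k, ‖R i k‖ ^ 2 + ∑ k, ‖R k j‖ ^ 2) / 2 := by
        rw [← Finset.sum_div, Finset.sum_add_distrib]
    _ ≤ _ := by linarith [hcol j, hrow i]

theorem isCompact_posSemidef_trace_le_one :
    IsCompact {M : Matrix ι ι ℂ | M.PosSemidef ∧ M.trace.re ≤ 1} := by
  refine IsCompact.of_isClosed_subset (s := Set.univ.pi fun _ : ι => Set.univ.pi fun _ : ι =>
    Metric.closedBall (0 : ℂ) 1)
    (isCompact_univ_pi fun _ => isCompact_univ_pi fun _ => isCompact_closedBall _ _) ?_ ?_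
  · exact isClosed_posSemidef.inter
      (isClosed_le (Complex.continuous_re.comp continuous_id.matrix_trace) continuous_const)
  · rintro M ⟨hM, htr⟩ i - j -
    rw [mem_closedBall_zero_iff]
    exact (norm_apply_le_trace_re hM i j).trans htr

theorem trace_re_nonneg {M : Matrix ι ι ℂ} (hM : M.PosSemidef) : 0 ≤ M.trace.re :=
  (Complex.nonneg_iff.mp hM.trace_nonneg).1

theorem eq_zero_of_trace_re_eq_zero {M : Matrix ι ι ℂ} (hM : M.PosSemidef)
    (h : M.trace.re = 0) : M = 0 := by
  ext i j
  exact norm_le_zero_iff.mp (h ▸ norm_apply_le_trace_re hM i j)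

theorem posSemidef_real_smul {M : Matrix ι ι ℂ} (hM : M.PosSemidef) {t : ℝ} (ht : 0 ≤ t) :
    (t • M).PosSemidef := by
  have := hM.smul (a := (t : ℂ)) (by exact_mod_cast ht)
  rwa [show (t : ℂ) • M = t • M by ext; simp] at this

/-- The pairs of positive semidefinite operators with total trace one. -/
def traceOnePairs (ι κ : Type*) [Fintype ι] [Fintype κ] :
    Set (Matrix ι ι ℂ × Matrix κ κ ℂ) :=
  {p | p.1.PosSemidef ∧ p.2.PosSemidef ∧ p.1.trace.re + p.2.trace.re = 1}

theorem convex_traceOnePairs : Convex ℝ (traceOnePairs ι κ) := by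
  rintro ⟨P, Q⟩ ⟨hP, hQ, h⟩ ⟨P', Q'⟩ ⟨hP', hQ', h'⟩ a b ha hb hab
  refine ⟨(posSemidef_real_smul hP ha).add (posSemidef_real_smul hP' hb),
    (posSemidef_real_smul hQ ha).add (posSemidef_real_smul hQ' hb), ?_⟩
  simp only [Prod.smul_mk, Prod.mk_add_mk, trace_add, trace_smul, Complex.add_re,
    Complex.real_smul, Complex.re_ofReal_mul] at h h' ⊢
  linear_combination a * h + b * h' + hab

theorem isCompact_traceOnePairs : IsCompact (traceOnePairs ι κ) := by
  refine IsCompact.of_isClosed_subset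
    ((isCompact_posSemidef_trace_le_one (ι := ι)).prod
      (isCompact_posSemidef_trace_le_one (ι := κ))) ?_ ?_
  · refine (isClosed_posSemidef.preimage continuous_fst).inter
      ((isClosed_posSemidef.preimage continuous_snd).inter (isClosed_eq ?_ continuous_const))
    exact (Complex.continuous_re.comp continuous_fst.matrix_trace).add
      (Complex.continuous_re.comp continuous_snd.matrix_trace)
  · rintro ⟨P, Q⟩ ⟨hP, hQ, h⟩
    have := trace_re_nonneg hP
    have := trace_re_nonneg hQ
    simp only at h this
    exact ⟨⟨hP, by dsimp only; linarith⟩, ⟨hQ, by dsimp only; linarith⟩⟩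

/-- Real linear functionals on Hermitian matrices are given by Hermitian matrices. -/
theorem exists_isHermitian_trace_eq [DecidableEq ζ] (g : Matrix ζ ζ ℂ →ₗ[ℝ] ℝ) :
    ∃ Z : Matrix ζ ζ ℂ, Z.IsHermitian ∧
      ∀ M : Matrix ζ ζ ℂ, M.IsHermitian → g M = (Z * M).trace.re := by
  -- For `M i j = x + y * I`, the real part of `Y j i * M i j` is `x * g(E_{ij}) + y * g(I *
  -- E_{ij})`.
  set Y : Matrix ζ ζ ℂ := Matrix.of fun j i =>
    (g (Matrix.single i j 1) : ℂ) - g (Matrix.single i j Complex.I) * Complex.I with hY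
  have h : ∀ M, g M = (Y * M).trace.re := by
    intro M
    have e : ∀ i j, Matrix.single i j (M i j) =
        (M i j).re • Matrix.single i j (1 : ℂ) + (M i j).im • Matrix.single i j Complex.I := by
      intro i j
      rw [Matrix.smul_single, Matrix.smul_single, ← Matrix.single_add]
      congr 1
      simp [Complex.re_add_im]
    conv_lhs => rw [Matrix.matrix_eq_sum_single M]
    simp only [e, map_sum, map_add, map_smul, smul_eq_mul, Matrix.trace, Matrix.diag,
      Matrix.mul_apply, Complex.re_sum]
    rw [Finset.sum_comm]
    refine Finset.sum_congr rfl fun j _ => Finset.sum_congr rfl fun i _ => ?_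
    simp [hY, Complex.mul_re, Complex.sub_re]
    ring
  -- Against Hermitian `M`, `Y` and `Yᴴ` have the same real trace pairing, so the Hermitian part of
  -- `Y` suffices.
  refine ⟨(1 / 2 : ℝ) • (Y + Yᴴ), ?_, fun M hM => ?_⟩
  · rw [IsHermitian, conjTranspose_smul, conjTranspose_add, conjTranspose_conjTranspose, add_comm,
      star_trivial]
  · have h2 : (Yᴴ * M).trace.re = (Y * M).trace.re := by
      rw [← Complex.conj_re, ← Complex.star_def, ← trace_conjTranspose, conjTranspose_mul,
        conjTranspose_conjTranspose, hM.eq, trace_mul_comm]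
    rw [Matrix.smul_mul, trace_smul, Complex.real_smul, Complex.re_ofReal_mul, Matrix.add_mul,
      trace_add, Complex.add_re, h2, h M]
    ring

/-! ### Separating functional and strong duality -/

theorem trace_one_kronecker_mul [DecidableEq κ] (Z : Matrix ζ ζ ℂ)
    (M : Matrix (κ × ζ) (κ × ζ) ℂ) :
    (((1 : Matrix κ κ ℂ) ⊗ₖ Z) * M).trace = (Z * trLeft M).trace := by
  simp only [Matrix.trace, Matrix.diag, Matrix.mul_apply, Fintype.sum_prod_type,
    kroneckerMap_apply, Matrix.one_apply, ite_mul, one_mul, zero_mul, trLeft, of_apply,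
    Finset.mul_sum]
  simp only [Finset.sum_ite_irrel, Finset.sum_const_zero, Finset.sum_ite_eq, Finset.mem_univ,
    if_true]
  rw [Finset.sum_comm]
  exact Finset.sum_congr rfl fun _ _ => Finset.sum_comm

theorem trace_trLeft (M : Matrix (κ × ζ) (κ × ζ) ℂ) : (trLeft M).trace = M.trace := by
  simp only [Matrix.trace, Matrix.diag, trLeft, of_apply, Fintype.sum_prod_type]
  exact Finset.sum_comm

theorem isHermitian_trLeft {M : Matrix (κ × ζ) (κ × ζ) ℂ} (hM : M.IsHermitian) :
    (trLeft M).IsHermitian := by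
  ext z z'
  simp only [conjTranspose_apply, trLeft, of_apply, star_sum]
  exact Finset.sum_congr rfl fun y _ => hM.apply _ _

/-- The constraint and the shifted objective of the primal problem as a real linear map. -/
def primalMap (A B : Matrix (κ × ζ) ι ℂ) (q : ℝ) :
    (Matrix ι ι ℂ × Matrix (κ × ζ) (κ × ζ) ℂ) →ₗ[ℝ] Matrix ζ ζ ℂ × ℝ where
  toFun p := (trLeft p.2 - trLeft (A * p.1 * Aᴴ),
    (hsInner (B * Bᴴ) p.2).re - q * p.1.trace.re)
  map_add' p p' := by
    refine Prod.ext ?_ ?_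
    · ext z z'
      simp only [Prod.fst_add, Prod.snd_add, Matrix.mul_add, Matrix.add_mul, trLeft,
        Matrix.add_apply, Matrix.sub_apply, of_apply, Finset.sum_add_distrib]
      ring
    · simp only [Prod.fst_add, Prod.snd_add, hsInner, Matrix.mul_add, trace_add, Complex.add_re]
      ring
  map_smul' t p := by
    refine Prod.ext ?_ ?_
    · ext z z'
      simp only [Prod.smul_fst, Prod.smul_snd, Matrix.mul_smul, Matrix.smul_mul, trLeft,
        Matrix.smul_apply, Matrix.sub_apply, of_apply, ← Finset.smul_sum, smul_sub,
        RingHom.id_apply]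
    · simp only [Prod.smul_fst, Prod.smul_snd, hsInner, Matrix.mul_smul, trace_smul,
        Complex.real_smul, Complex.re_ofReal_mul, RingHom.id_apply, smul_eq_mul]
      ring

/-- Zero defect with `ρ = 0` would force `Tr W = 0`, against total trace one. So `Tr ρ > 0`, and
dividing by it gives a feasible pair of value `< q`. -/
theorem primalMap_notMem_ray {A B : Matrix (κ × ζ) ι ℂ} {q : ℝ}
    (hq : ∀ ρ W, PrimalFeasible A ρ W → (hsInner (B * Bᴴ) W).re < q)
    {p : Matrix ι ι ℂ × Matrix (κ × ζ) (κ × ζ) ℂ} (hp : p ∈ traceOnePairs ι (κ × ζ))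
    (h1 : (primalMap A B q p).1 = 0) : (primalMap A B q p).2 < 0 := by
  classical
  obtain ⟨ρ, W⟩ := p
  obtain ⟨hρ, hW, htr⟩ := hp
  change trLeft W - trLeft (A * ρ * Aᴴ) = 0 at h1
  change (hsInner (B * Bᴴ) W).re - q * ρ.trace.re < 0
  dsimp only at hρ hW htr
  have h1 := sub_eq_zero.mp h1
  rcases (trace_re_nonneg hρ).eq_or_lt with h0 | h0
  · exfalso
    have hρ0 := eq_zero_of_trace_re_eq_zero hρ h0.symm
    rw [← trace_trLeft W, h1, trace_trLeft, hρ0, Matrix.mul_zero, Matrix.zero_mul, trace_zero]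
      at htr
    simp at htr
  · set t := ρ.trace.re with ht
    have hρt : ρ.trace = (t : ℂ) :=
      Complex.ext rfl (by simpa using (Complex.nonneg_iff.mp hρ.trace_nonneg).2.symm)
    have hf : PrimalFeasible A (t⁻¹ • ρ) (t⁻¹ • W) := by
      refine ⟨⟨posSemidef_real_smul hρ (inv_nonneg.mpr h0.le), ?_⟩,
        posSemidef_real_smul hW (inv_nonneg.mpr h0.le), ?_⟩
      · rw [trace_smul, hρt, Complex.real_smul, ← Complex.ofReal_mul, inv_mul_cancel₀ h0.ne',
          Complex.ofReal_one]
      · ext z z'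
        have := congrFun₂ h1 z z'
        simp only [trLeft, of_apply, Matrix.mul_smul, Matrix.smul_mul, Matrix.smul_apply,
          ← Finset.smul_sum] at this ⊢
        rw [this]
    have := hq _ _ hf
    rw [hsInner, Matrix.mul_smul, trace_smul, Complex.real_smul, Complex.re_ofReal_mul,
      inv_mul_lt_iff₀ h0] at this
    rw [hsInner]
    linarith

/-- The separating functional behind strong duality. -/
theorem exists_separating [DecidableEq ζ] {A B : Matrix (κ × ζ) ι ℂ} {q : ℝ}
    (hq : ∀ ρ W, PrimalFeasible A ρ W → (hsInner (B * Bᴴ) W).re < q) :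
    ∃ (Z : Matrix ζ ζ ℂ) (c u : ℝ), Z.IsHermitian ∧ 0 ≤ c ∧ u < 0 ∧
      ∀ (ρ : Matrix ι ι ℂ) (W : Matrix (κ × ζ) (κ × ζ) ℂ), ρ.PosSemidef → W.PosSemidef →
        (Z * trLeft W).trace.re - (Z * trLeft (A * ρ * Aᴴ)).trace.re +
          c * ((hsInner (B * Bᴴ) W).re - q * ρ.trace.re) ≤ u * (ρ.trace.re + W.trace.re) := by
  have : LocallyConvexSpace ℝ (Matrix ζ ζ ℂ) :=
    inferInstanceAs (LocallyConvexSpace ℝ (ζ → ζ → ℂ))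
  -- Working on the compact base of the cone instead of the cone gives strict separation, hence the
  -- margin `u < 0`, without a Slater condition.
  obtain ⟨f, u, v, hfu, huv, hfv⟩ := geometric_hahn_banach_compact_closed
    (s := primalMap A B q '' traceOnePairs ι (κ × ζ))
    (t := ({0} : Set (Matrix ζ ζ ℂ)) ×ˢ Set.Ici (0 : ℝ))
    (convex_traceOnePairs.linear_image _)
    (isCompact_traceOnePairs.image (LinearMap.continuous_of_finiteDimensional _))
    ((convex_singleton 0).prod (convex_Ici 0)) (isClosed_singleton.prod isClosed_Ici)
    (by
      rw [Set.disjoint_left]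
      rintro _ ⟨p, hp, rfl⟩ ⟨h1, h2⟩
      exact (primalMap_notMem_ray hq hp h1).not_ge h2)
  have h00 : f ((0 : Matrix ζ ζ ℂ), (0 : ℝ)) = 0 := map_zero f
  have hv : v < 0 := h00 ▸ hfv (0, 0) ⟨rfl, le_refl (0 : ℝ)⟩
  have hf : ∀ M t, f (M, t) = f (M, 0) + t * f (0, 1) := by
    intro M t
    rw [← smul_eq_mul, ← map_smul, ← map_add]
    simp
  have hc : 0 ≤ f (0, 1) := by
    by_contra! h
    have := hfv (0, v / f (0, 1)) ⟨rfl, (div_pos_of_neg_of_neg hv h).le⟩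
    rw [hf, div_mul_cancel₀ _ h.ne] at this
    linarith
  obtain ⟨Z, hZ, hfZ⟩ := exists_isHermitian_trace_eq
    (f.toLinearMap ∘ₗ LinearMap.inl ℝ (Matrix ζ ζ ℂ) ℝ)
  refine ⟨Z, f (0, 1), u, hZ, hc, huv.trans hv, fun ρ W hρ hW => ?_⟩
  have hval : f (primalMap A B q (ρ, W)) =
      (Z * trLeft W).trace.re - (Z * trLeft (A * ρ * Aᴴ)).trace.re +
          f (0, 1) * ((hsInner (B * Bᴴ) W).re - q * ρ.trace.re) := by
    change f (trLeft W - trLeft (A * ρ * Aᴴ), (hsInner (B * Bᴴ) W).re - q * ρ.trace.re) = _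
    rw [hf, mul_comm (f (0, 1))]
    have := hfZ (trLeft W - trLeft (A * ρ * Aᴴ)) ((isHermitian_trLeft hW.1).sub
      (isHermitian_trLeft (hρ.mul_mul_conjTranspose_same A).1))
    rw [Matrix.mul_sub, trace_sub, Complex.sub_re] at this
    rw [← this]
    rfl
  rw [← hval]
  have hρ0 := trace_re_nonneg hρ
  have hW0 := trace_re_nonneg hW
  -- Homogeneity carries the inequality from total trace one to the whole cone.
  rcases (add_nonneg hρ0 hW0).eq_or_lt with h0 | h0
  · have h1 := eq_zero_of_trace_re_eq_zero hρ (by linarith)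
    have h2 := eq_zero_of_trace_re_eq_zero hW (by linarith)
    subst h1 h2
    rw [← Prod.zero_eq_mk, map_zero, map_zero]
    simp
  · set t := ρ.trace.re + W.trace.re with ht
    have hmem : (t⁻¹ • (ρ, W)) ∈ traceOnePairs ι (κ × ζ) := by
      refine ⟨posSemidef_real_smul hρ (inv_nonneg.mpr h0.le),
        posSemidef_real_smul hW (inv_nonneg.mpr h0.le), ?_⟩
      simp only [Prod.smul_mk, trace_smul, Complex.real_smul, Complex.re_ofReal_mul]
      rw [← mul_add, ← ht, inv_mul_cancel₀ h0.ne']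
    have := hfu _ ⟨_, hmem, rfl⟩
    rw [map_smul, map_smul, smul_eq_mul, inv_mul_lt_iff₀ h0] at this
    linarith

/-- Strong duality: a strict upper bound of the primal problem is not a lower bound of the dual
problem. -/
theorem exists_dualFeasible_lt [DecidableEq ι] [DecidableEq κ] [DecidableEq ζ] [Nonempty ι]
    [Nonempty κ] {A B : Matrix (κ × ζ) ι ℂ} {q : ℝ}
    (hq : ∀ ρ W, PrimalFeasible A ρ W → (hsInner (B * Bᴴ) W).re < q) :
    ∃ Z : Matrix ζ ζ ℂ, DualFeasible B Z ∧
      spectralNorm (Aᴴ * ((1 : Matrix κ κ ℂ) ⊗ₖ Z) * A) < q := by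
  obtain ⟨Y, c, u, hY, hc, hu, hsep⟩ := exists_separating hq
  have hBB : (B * Bᴴ)ᴴ = B * Bᴴ := (isHermitian_mul_conjTranspose_self B).eq
  have hW : ∀ W : Matrix (κ × ζ) (κ × ζ) ℂ, W.PosSemidef →
      c * (B * Bᴴ * W).trace.re ≤ -(((1 : Matrix κ κ ℂ) ⊗ₖ Y) * W).trace.re := by
    intro W hW
    have h1 := hsep 0 W PosSemidef.zero hW
    have h2 : (trLeft (A * (0 : Matrix ι ι ℂ) * Aᴴ)) = 0 := by ext; simp [trLeft]
    rw [h2, Matrix.mul_zero, trace_zero, trace_zero, Complex.zero_re, hsInner, hBB] at h1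
    have h3 := mul_nonpos_of_nonpos_of_nonneg hu.le (trace_re_nonneg hW)
    rw [trace_one_kronecker_mul]
    linarith
  have hcyc : ∀ (Z : Matrix ζ ζ ℂ) (ρ : Matrix ι ι ℂ), (Z * trLeft (A * ρ * Aᴴ)).trace =
      (Aᴴ * ((1 : Matrix κ κ ℂ) ⊗ₖ Z) * A * ρ).trace := by
    intro Z ρ
    rw [← trace_one_kronecker_mul, ← Matrix.mul_assoc, Matrix.trace_mul_comm]
    simp only [Matrix.mul_assoc]
  have hρ : ∀ ρ : Matrix ι ι ℂ, ρ.PosSemidef →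
      -(Aᴴ * ((1 : Matrix κ κ ℂ) ⊗ₖ Y) * A * ρ).trace.re ≤ (c * q + u) * ρ.trace.re := by
    intro ρ hρ
    have h1 := hsep ρ 0 hρ PosSemidef.zero
    have h2 : (trLeft (0 : Matrix (κ × ζ) (κ × ζ) ℂ)) = 0 := by ext; simp [trLeft]
    rw [h2, Matrix.mul_zero, trace_zero, hsInner, Matrix.mul_zero, trace_zero, Complex.zero_re,
      hcyc] at h1
    linarith
  have hcard : (0 : ℝ) < (1 : Matrix ι ι ℂ).trace.re := by
    rw [trace_one, Complex.natCast_re]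
    exact_mod_cast Fintype.card_pos
  have hkh : ∀ Z : Matrix ζ ζ ℂ, Z.IsHermitian → ((1 : Matrix κ κ ℂ) ⊗ₖ Z).IsHermitian := by
    intro Z hZ
    rw [IsHermitian, conjTranspose_kronecker, conjTranspose_one, hZ.eq]
  -- If `c = 0`, then `1 ⊗ (-Y) ≥ 0`, yet taking `ρ = 1` makes the trace of `Aᴴ (1 ⊗ (-Y)) A` at
  -- most `u * Tr 1 < 0`.
  have hcpos : 0 < c := by
    refine hc.lt_of_ne fun h0 => ?_
    have h1 : ((1 : Matrix κ κ ℂ) ⊗ₖ (-Y)).PosSemidef := by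
      refine posSemidef_of_trace_mul_nonneg (hkh _ hY.neg) fun W hWp => ?_
      have h1 := hW W hWp
      rw [trace_one_kronecker_mul] at h1 ⊢
      rw [Matrix.neg_mul, trace_neg, Complex.neg_re]
      rw [← h0] at h1
      linarith
    have h2 := trace_re_nonneg (h1.conjTranspose_mul_mul_same A)
    have h3 := hρ 1 PosSemidef.one
    rw [← hcyc] at h3
    rw [← Matrix.mul_one (Aᴴ * _ * A), ← hcyc, Matrix.neg_mul, trace_neg, Complex.neg_re] at h2
    rw [← h0, zero_mul, zero_add] at h3
    linarith [mul_neg_of_neg_of_pos hu hcard]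
  set Z : Matrix ζ ζ ℂ := c⁻¹ • (-Y) with hZdef
  have hZh : Z.IsHermitian := by
    rw [IsHermitian, hZdef, conjTranspose_smul, hY.neg.eq, star_trivial]
  have hZtr : ∀ M : Matrix ζ ζ ℂ, (Z * M).trace.re = c⁻¹ * (-(Y * M).trace.re) := by
    intro M
    rw [hZdef, Matrix.smul_mul, trace_smul, Complex.real_smul, Complex.re_ofReal_mul,
      Matrix.neg_mul, trace_neg, Complex.neg_re]
  have hdual : ((1 : Matrix κ κ ℂ) ⊗ₖ Z - B * Bᴴ).PosSemidef := by
    refine posSemidef_of_trace_mul_nonneg ((hkh Z hZh).sub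
      (isHermitian_mul_conjTranspose_self B)) fun W hWp => ?_
    have h1 := hW W hWp
    rw [trace_one_kronecker_mul] at h1
    rw [Matrix.sub_mul, trace_sub, Complex.sub_re, trace_one_kronecker_mul, hZtr, sub_nonneg,
      le_inv_mul_iff₀ hcpos]
    exact h1
  have hkZ : ((1 : Matrix κ κ ℂ) ⊗ₖ Z).PosSemidef := by
    have := hdual.add (posSemidef_self_mul_conjTranspose B)
    rwa [sub_add_cancel] at this
  -- `Z` is a diagonal block of `1 ⊗ Z`.
  have hZ : Z.PosSemidef := by
    obtain ⟨y⟩ := ‹Nonempty κ›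
    have := hkZ.submatrix (fun z => (y, z))
    convert this using 1
    ext z z'
    simp
  have hAZ := hkZ.conjTranspose_mul_mul_same A
  have hbound : ∀ ρ : Matrix ι ι ℂ, ρ.PosSemidef →
      (Aᴴ * ((1 : Matrix κ κ ℂ) ⊗ₖ Z) * A * ρ).trace.re ≤ (q + u / c) * ρ.trace.re := by
    intro ρ hρp
    have h1 := hρ ρ hρp
    rw [← hcyc] at h1 ⊢
    rw [hZtr, inv_mul_le_iff₀ hcpos]
    refine h1.trans_eq ?_
    field_simp
  -- The bound `q + u / c` lies strictly below `q` because `u < 0 < c`.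
  refine ⟨Z, ⟨hZ, hdual⟩, lt_of_le_of_lt (spectralNorm_le_of_posSemidef hAZ (c := q + u / c) ?_ ?_)
    (by linarith [div_neg_of_neg_of_pos hu hcpos])⟩
  · have h1 := hbound 1 PosSemidef.one
    rw [Matrix.mul_one] at h1
    exact nonneg_of_mul_nonneg_left ((trace_re_nonneg hAZ).trans h1) hcard
  · refine posSemidef_of_trace_mul_nonneg (IsHermitian.sub ?_ hAZ.1) fun ρ hρp => ?_
    · rw [IsHermitian, conjTranspose_smul, conjTranspose_one, RCLike.star_def, Complex.conj_ofReal]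
    · rw [Matrix.sub_mul, trace_sub, Complex.sub_re, sub_nonneg, Matrix.smul_mul, Matrix.one_mul,
        trace_smul, smul_eq_mul, Complex.re_ofReal_mul]
      exact hbound ρ hρp

/-- Dual feasibility does not involve `A`. For `A = 0` the constraint forces `W = 0`, so strong
duality with `q = 1` supplies a point. -/
theorem exists_dualFeasible [DecidableEq ι] [DecidableEq κ] [DecidableEq ζ] [Nonempty ι]
    [Nonempty κ] (B : Matrix (κ × ζ) ι ℂ) : ∃ Z : Matrix ζ ζ ℂ, DualFeasible B Z := by
  obtain ⟨Z, hZ, -⟩ := exists_dualFeasible_lt (A := 0) (B := B) (q := 1) fun ρ W ⟨_, hW, h⟩ => by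
    have htr : W.trace = 0 := by
      rw [← trace_trLeft, h, trace_trLeft, Matrix.zero_mul, Matrix.zero_mul, trace_zero]
    rw [eq_zero_of_trace_re_eq_zero hW (by rw [htr, Complex.zero_re])]
    simp [hsInner]
  exact ⟨Z, hZ⟩

end Separation

end CBTraceNorm

end

theorem mainTheorem1 (n m r : ℕ) (hn : 1 ≤ n) (hm : 1 ≤ m)
    (Φ : CBTraceNorm.SuperOp (Fin n) (Fin m))
    (A B : Matrix (Fin m × Fin r) (Fin n) ℂ)
    (hAB : CBTraceNorm.IsStinespringPair Φ A B)
    (hr : r = (CBTraceNorm.choi Φ).rank) :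
    CBTraceNorm.cbTraceNorm Φ ≠ ⊤ ∧
      IsGreatest (CBTraceNorm.primalValues A B) ((CBTraceNorm.cbTraceNorm Φ).toReal ^ 2) ∧
      IsGLB (CBTraceNorm.dualValues A B) ((CBTraceNorm.cbTraceNorm Φ).toReal ^ 2) := by
  have : Nonempty (Fin n) := ⟨⟨0, hn⟩⟩
  have : Nonempty (Fin m) := ⟨⟨0, hm⟩⟩
  obtain ⟨Z₀, hZ₀⟩ := CBTraceNorm.exists_dualFeasible B
  have hΦ : CBTraceNorm.cbTraceNorm Φ ≠ ⊤ :=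
    ((CBTraceNorm.cbTraceNorm_le_of_dualFeasible hAB hZ₀).trans_lt ENNReal.ofReal_lt_top).ne
  have hprimal := fun ρ W => CBTraceNorm.primalFeasible_le_cbTraceNorm_sq hΦ hAB (ρ := ρ) (W := W)
  have hdual := fun Z => CBTraceNorm.cbTraceNorm_toReal_sq_le hAB (Z := Z)
  refine ⟨hΦ, ⟨?_, ?_⟩, ?_, ?_⟩
  -- If `|||Φ|||₁²` were not attained, it would be a strict upper bound of the primal values, and
  -- some dual value would lie below it, against weak duality.
  · by_contra hnot
    obtain ⟨Z, hZ, hlt⟩ := CBTraceNorm.exists_dualFeasible_lt (A := A) (B := B)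
      (q := (CBTraceNorm.cbTraceNorm Φ).toReal ^ 2) fun ρ W h =>
        (hprimal ρ W h).lt_of_ne fun he => hnot ⟨ρ, W, h, he.symm⟩
    exact hlt.not_ge (hdual Z hZ)
  · rintro _ ⟨ρ, W, h, rfl⟩
    exact hprimal ρ W h
  · rintro _ ⟨Z, hZ, rfl⟩
    exact hdual Z hZ
  · refine fun b hb => le_of_forall_gt fun q hq => ?_
    obtain ⟨Z, hZ, hlt⟩ := CBTraceNorm.exists_dualFeasible_lt (A := A) (B := B)
      fun ρ W h => (hprimal ρ W h).trans_lt hq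
    exact (hb ⟨Z, hZ, rfl⟩).trans_lt hlt
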